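/- Let $D$ be a finite set. A relation over $D$ is a subset $R\subseteq D^k$ together with its arity $k$. For a finite set $\Gamma$ of relations over $D$, an instance of $\mathrm{CSP}(\Gamma)$ consists of a finite set $V$ of variables and a finite set $C$ of constraint applications $R(x_1,\dots,x_k)$ with $R\in\Gamma$ of arity $k$ and $x_1,\dots,x_k\in V$. The question is whether there is a map $f:V\to D$ with $(f(x_1),\dots,f(x_k))\in R$ for every $R(x_1,\dots,x_k)\in C$. Let $$\mathsf T(\Gamma)=\inf\{c\ge 0 \mid \mathrm{CSP}(\Gamma)\text{ is solvable in time } O(2^{cn})\},$$ where $n=|V|$ is the number of variables of the instance and time is the number of steps of a deterministic algorithm (formally, a While-program over binary trees in which every elementary operation costs one step). Let $R_D^{S}=\{t_1,t_2,t_3\}$ be the $|D|^3$-ary relation over $D$ such that for every $(d_1,d_2,d_3)\in D^3$ there is an index $i$ with $(t_1[i],t_2[i],t_3[i])=(d_1,d_2,d_3)$; it is unique up to the order of its arguments, which may be chosen arbitrarily. Let $2^D$ denote the set of all unary relations over $D$. **Theorem.** For every finite set $D$, $\ \mathsf T(\{R_D^{S}\})=\mathsf T(\{R_D^{S}\}\cup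 2^D)$. -/

import Mathlib

open scoped NNReal ENNReal

namespace CSP

/-! ### Relations, constraint languages and the constraint satisfaction problem -/

/-- A finitary relation over `D`: an arity `k` together with a subset of `D ^ k`. -/
structure Rel (D : Type*) where
  arity : ℕ
  tuples : Set (Fin arity → D)

/-- The unary relation `{(d) | d ∈ E}`. -/
def unaryRel {D : Type*} (E : Set D) : Rel D where
  arity := 1
  tuples := {t | t 0 ∈ E}

/-- `2 ^ D`, the set of all unary relations over `D`. -/
def allUnary (D : Type*) : Set (Rel D) :=
  Set.range (unaryRel (D := D))

/-- The saturated relation over `D`: the `|D| ^ 3`-ary relation `{t₁, t₂, t₃}` in which the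
columns `(t₁ i, t₂ i, t₃ i)` run through all of `D ^ 3`. It is determined up to the order of
its arguments; `col` is that order (its `i`-th column is `col i`). -/
def saturatedRel {D : Type*} [Fintype D]
    (col : Fin (Fintype.card D ^ 3) ≃ D × D × D) : Rel D where
  arity := Fintype.card D ^ 3
  tuples := {fun i => (col i).1, fun i => (col i).2.1, fun i => (col i).2.2}

/-- A constraint application `R(x₁, …, x_k)` with `R ∈ Γ` and variables in `Fin n`. -/
structure Constraint {D : Type*} (Γ : Set (Rel D)) (n : ℕ) where
  rel : Rel D
  rel_mem : rel ∈ Γ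
  scope : Fin rel.arity → Fin n

/-- An instance of `CSP(Γ)`: the set of variables is `{0, …, numVars - 1}`, and the finite set of
constraint applications is given by a list without repetitions (in any order). -/
structure Instance {D : Type*} (Γ : Set (Rel D)) where
  numVars : ℕ
  constraints : List (Constraint Γ numVars)
  nodup : constraints.Nodup

/-- The question of `CSP(Γ)`. -/
def Instance.Satisfiable {D : Type*} {Γ : Set (Rel D)} (I : Instance Γ) : Prop :=
  ∃ f : Fin I.numVars → D, ∀ c ∈ I.constraints, (fun j => f (c.scope j)) ∈ c.rel.tuples

/-! ### The model of computation: While-programs over binary trees with unit-cost operations -/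

/-- The data values: binary trees, built from `nil` by pairing. -/
inductive BinTree : Type
  | nil : BinTree
  | cons : BinTree → BinTree → BinTree

/-- Expressions over the program registers `0, 1, 2, …`. -/
inductive Term : Type
  | reg : ℕ → Term
  | nil : Term
  | cons : Term → Term → Term
  | hd : Term → Term
  | tl : Term → Term

/-- A store: the contents of the registers. -/
abbrev Store : Type := ℕ → BinTree

/-- The first component of a pair (and `nil` for `nil`). -/
def BinTree.hd : BinTree → BinTree
  | .nil => .nil
  | .cons a _ => a

/-- The second component of a pair (and `nil` for `nil`). -/
def BinTree.tl : BinTree → BinTree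
  | .nil => .nil
  | .cons _ b => b

/-- The value of an expression. -/
def Term.eval (s : Store) : Term → BinTree
  | .reg i => s i
  | .nil => .nil
  | .cons e f => .cons (e.eval s) (f.eval s)
  | .hd e => (e.eval s).hd
  | .tl e => (e.eval s).tl

/-- The cost of evaluating an expression: one step for each operation in it. -/
def Term.cost : Term → ℕ
  | .reg _ => 1
  | .nil => 1
  | .cons e f => e.cost + f.cost + 1
  | .hd e => e.cost + 1
  | .tl e => e.cost + 1

/-- While-programs. A test succeeds when its value is not `nil`. -/
inductive Program : Type
  | assign : ℕ → Term → Program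
  | seq : Program → Program → Program
  | cond : Term → Program → Program → Program
  | loop : Term → Program → Program

/-- `Exec p s t s'`: started in the store `s`, the program `p` halts after exactly `t` steps, in
the store `s'`. -/
inductive Exec : Program → Store → ℕ → Store → Prop
  | assign (i : ℕ) (e : Term) (s : Store) :
      Exec (.assign i e) s (e.cost + 1) (Function.update s i (e.eval s))
  | seq {p q : Program} {s s₁ s₂ : Store} {t₁ t₂ : ℕ} :
      Exec p s t₁ s₁ → Exec q s₁ t₂ s₂ → Exec (.seq p q) s (t₁ + t₂) s₂
  | cond_true {e : Term} {p q : Program} {s s' : Store} {t : ℕ} :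
      e.eval s ≠ .nil → Exec p s t s' → Exec (.cond e p q) s (e.cost + 1 + t) s'
  | cond_false {e : Term} {p q : Program} {s s' : Store} {t : ℕ} :
      e.eval s = .nil → Exec q s t s' → Exec (.cond e p q) s (e.cost + 1 + t) s'
  | loop_done {e : Term} {p : Program} {s : Store} :
      e.eval s = .nil → Exec (.loop e p) s (e.cost + 1) s
  | loop_step {e : Term} {p : Program} {s s₁ s₂ : Store} {t₁ t₂ : ℕ} :
      e.eval s ≠ .nil → Exec p s t₁ s₁ → Exec (.loop e p) s₁ t₂ s₂ →
      Exec (.loop e p) s (e.cost + 1 + t₁ + t₂) s₂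

/-- Programs are deterministic: the running time and the final store are unique. -/
theorem Exec.deterministic {p : Program} {s s₁ s₂ : Store} {t₁ t₂ : ℕ}
    (h₁ : Exec p s t₁ s₁) (h₂ : Exec p s t₂ s₂) : t₁ = t₂ ∧ s₁ = s₂ := by
  induction h₁ generalizing t₂ s₂ with
  | assign i e s => cases h₂; exact ⟨rfl, rfl⟩
  | seq _ _ ih ih' =>
    cases h₂ with
    | seq a b =>
      obtain ⟨rfl, rfl⟩ := ih a
      obtain ⟨rfl, rfl⟩ := ih' b
      exact ⟨rfl, rfl⟩
  | cond_true h _ ih =>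
    cases h₂ with
    | cond_true _ a => obtain ⟨rfl, rfl⟩ := ih a; exact ⟨rfl, rfl⟩
    | cond_false h' _ => exact absurd h' h
  | cond_false h _ ih =>
    cases h₂ with
    | cond_true h' _ => exact absurd h h'
    | cond_false _ a => obtain ⟨rfl, rfl⟩ := ih a; exact ⟨rfl, rfl⟩
  | loop_done h =>
    cases h₂ with
    | loop_done _ => exact ⟨rfl, rfl⟩
    | loop_step h' _ _ => exact absurd h h'
  | loop_step h _ _ ih ih' =>
    cases h₂ with
    | loop_done h' => exact absurd h' h
    | loop_step _ a b =>
      obtain ⟨rfl, rfl⟩ := ih a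
      obtain ⟨rfl, rfl⟩ := ih' b
      exact ⟨rfl, rfl⟩

/-- The initial store: the input is in register `0` and all other registers are empty. -/
def inputStore (w : BinTree) : Store :=
  Function.update (fun _ => BinTree.nil) 0 w

/-! ### Encoding of instances and the function `T` -/

/-- A list of trees as a tree. -/
def BinTree.ofList : List BinTree → BinTree
  | [] => .nil
  | a :: l => .cons a (BinTree.ofList l)

/-- A natural number in unary. -/
def BinTree.ofNat (n : ℕ) : BinTree :=
  BinTree.ofList (List.replicate n .nil)

/-- The encoding of a constraint application: the name of its relation, followed by the list of
its variables. -/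
def Constraint.encode {D : Type*} {Γ : Set (Rel D)} {n : ℕ} (name : Rel D → BinTree)
    (c : Constraint Γ n) : BinTree :=
  .cons (name c.rel) (BinTree.ofList (List.ofFn fun j => BinTree.ofNat (c.scope j)))

/-- The encoding of an instance: the number of variables, followed by the list of constraints.
The relations are referred to by the names that `name` gives to them. -/
def Instance.encode {D : Type*} {Γ : Set (Rel D)} (name : Rel D → BinTree)
    (I : Instance Γ) : BinTree :=
  .cons (BinTree.ofNat I.numVars)
    (BinTree.ofList (I.constraints.map fun C => C.encode name))

/-- `CSP(Γ)` is solvable in time `O(2 ^ (c * n))`, where `n` is the number of variables: some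
program halts on every instance within that time, with the correct answer (non-`nil` for yes,
`nil` for no) in register `0`. The finitely many relations in `Γ` are given distinct names. -/
def SolvableInTime {D : Type*} (Γ : Set (Rel D)) (c : ℝ≥0) : Prop :=
  ∃ name : Rel D → BinTree, Set.InjOn name Γ ∧
    ∃ (p : Program) (K : ℕ), ∀ I : Instance Γ,
      ∃ (t : ℕ) (s : Store), Exec p (inputStore (I.encode name)) t s ∧
        (s 0 ≠ .nil ↔ I.Satisfiable) ∧
        (t : ℝ) ≤ K * (2 : ℝ) ^ ((c : ℝ) * (I.numVars : ℝ))

/-- `T(Γ) = inf {c | CSP(Γ) is solvable in time 2 ^ (c * n)}`, for a finite set `Γ` of relations. -/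
noncomputable def T {D : Type*} (Γ : Set (Rel D)) : ℝ≥0∞ :=
  ⨅ (c : ℝ≥0) (_ : SolvableInTime Γ c), (c : ℝ≥0∞)

end CSP

/-! One inequality is monotonicity (`T_mono`). For the other, an instance with unary constraints is
turned, in polynomial time and on the same variables, into an instance over the saturated relation
alone. Polynomial factors are absorbed by `2 ^ (ε * n)`, and the infimum does not see `ε`
(`SolvableInTime.of_reduction`, `T_le_of_forall_pos`).

The reduction rests on `exists_excluding`. Since every column occurs, the arguments can be reindexed
by a map `σ i` that fixes the other tuples and makes `t i` constant; for `|D| ≥ 2` no constant tuple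
lies in the relation. Next to the constraint with scope `w`, the constraint with scope `w ∘ σ i`
therefore forbids exactly the tuple `t i` at `w`. Adding it whenever `t i` violates a unary
constraint on `w` forces admissible values on all scopes. Variables in no scope remain free, so for
them it is enough that an admissible value exists, which is checked directly
(`Instance.satisfiable_iff`).

The remaining work shows that While-programs can do this in time polynomial in `n`. Polynomial-time
functions are closed under composition, branching and folds of controlled growth. Encodings have
size polynomial in `n`, because constraint lists have no repetitions (`exists_size_encode_le`). -/

namespace CSP

/-! ### Trees as lists -/

namespace BinTree

/-- The number of pairs in a tree. -/
def size : BinTree → ℕ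
  | nil => 0
  | cons a b => a.size + b.size + 1

/-- Every tree is a list of trees. -/
def toList : BinTree → List BinTree
  | nil => []
  | cons a b => a :: b.toList

@[simp] theorem toList_ofList (l : List BinTree) : (ofList l).toList = l := by
  induction l with
  | nil => rfl
  | cons a l ih => simp [ofList, toList, ih]

/-- The `j`-th entry of a tree as a list. -/
def nth (j : ℕ) (t : BinTree) : BinTree := (tl^[j] t).hd

theorem nth_ofList_ofFn {k : ℕ} (g : Fin k → BinTree) (j : Fin k) :
    nth j (ofList (List.ofFn g)) = g j := by
  induction k with
  | zero => exact j.elim0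
  | succ k ih =>
    rw [List.ofFn_succ]
    refine Fin.cases ?_ (fun j => ?_) j
    · rfl
    · simpa [nth, ofList, tl] using ih (fun i => g i.succ) j

/-- The length of a tree as a list. -/
def len (t : BinTree) : ℕ := t.toList.length

@[simp] theorem len_ofNat (n : ℕ) : (ofNat n).len = n := by simp [len, ofNat]

theorem len_eq_zero {t : BinTree} : t.len = 0 ↔ t = nil := by
  cases t <;> simp [len, toList]

theorem len_tl (t : BinTree) : t.tl.len = t.len - 1 := by
  cases t <;> simp [len, toList, tl]

theorem size_tl_le (t : BinTree) : t.tl.size ≤ t.size := by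
  cases t <;> simp only [tl, size] <;> omega

theorem size_hd_le (t : BinTree) : t.hd.size ≤ t.size := by
  cases t <;> simp only [hd, size] <;> omega

theorem len_le_size (t : BinTree) : t.len ≤ t.size := by
  induction t with
  | nil => simp [len, toList]
  | cons a b _ ih => simp only [len, toList, size, List.length_cons] at *; omega

/-- The truth value of a proposition. -/
noncomputable def ofProp (p : Prop) : BinTree := by
  classical exact if p then cons nil nil else nil

@[simp] theorem ofProp_eq_nil {p : Prop} : ofProp p = nil ↔ ¬ p := by
  unfold ofProp; split <;> simp_all

theorem ofProp_true {p : Prop} (h : p) : ofProp p = cons nil nil := by simp [ofProp, h]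

theorem ofProp_false {p : Prop} (h : ¬ p) : ofProp p = nil := by simp [ofProp, h]

theorem size_ofProp_le (p : Prop) : (ofProp p).size ≤ 1 := by
  unfold ofProp; split <;> simp [size]

end BinTree

open BinTree

theorem eval_mono (P : Polynomial ℕ) {m n : ℕ} (h : m ≤ n) : P.eval m ≤ P.eval n := by
  induction P using Polynomial.induction_on' with
  | add p q hp hq => simpa using add_le_add hp hq
  | monomial k a => simpa using Nat.mul_le_mul_left a (Nat.pow_le_pow_left h k)

/-! ### Functions computable in polynomial time -/

/-- `p` replaces the content `x` of register `r` by `f x`, in at most `B x` steps, without changing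
the registers below `r`. -/
def Computes (p : Program) (r : ℕ) (f : BinTree → BinTree) (B : BinTree → ℕ) : Prop :=
  ∀ s : Store, ∃ (t : ℕ) (s' : Store), Exec p s t s' ∧ s' r = f (s r) ∧
    (∀ i < r, s' i = s i) ∧ t ≤ B (s r)

/-- `f` is computable in polynomial time, by a program that can be placed at any register, and its
values have polynomial size. -/
def PolyTime (f : BinTree → BinTree) : Prop :=
  ∃ (p : ℕ → Program) (P : Polynomial ℕ),
    (∀ r, Computes (p r) r f fun x => P.eval x.size) ∧ ∀ x, (f x).size ≤ P.eval x.size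

theorem PolyTime.of_term {f : BinTree → BinTree} (e : ℕ → Term) (C : ℕ)
    (he : ∀ r s, (e r).eval s = f (s r)) (hc : ∀ r, (e r).cost ≤ C)
    (hs : ∀ x, (f x).size ≤ x.size + C) : PolyTime f := by
  refine ⟨fun r => .assign r (e r), Polynomial.X + ((C + 1 : ℕ) : Polynomial ℕ),
    fun r s => ?_, fun x => ?_⟩
  · refine ⟨_, _, .assign _ _ _, by simp [he], fun i hi => ?_, ?_⟩
    · simp [Function.update_of_ne hi.ne]
    · have := hc r
      simp only [Polynomial.eval_add, Polynomial.eval_X, Polynomial.eval_natCast]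
      simp only [Nat.cast_id]
      omega
  · have := hs x
    simp only [Polynomial.eval_add, Polynomial.eval_X, Polynomial.eval_natCast]
    simp only [Nat.cast_id]
    omega

theorem PolyTime.id : PolyTime fun x => x :=
  .of_term (fun r => .reg r) 1 (fun _ _ => rfl) (fun _ => le_rfl) (fun _ => by simp)

theorem PolyTime.const (c : BinTree) : PolyTime fun _ => c := by
  have : ∃ e : Term, ∀ s, e.eval s = c := by
    induction c with
    | nil => exact ⟨.nil, fun _ => rfl⟩
    | cons a b iha ihb =>
      obtain ⟨e, he⟩ := iha
      obtain ⟨e', he'⟩ := ihb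
      exact ⟨.cons e e', fun s => by simp [Term.eval, he, he']⟩
  obtain ⟨e, he⟩ := this
  exact .of_term (fun _ => e) (e.cost + c.size) (fun _ s => he s) (fun _ => by omega)
    (fun _ => by omega)

/-- This is what the size bound in `PolyTime` is for: the outer program runs on an input of size at
most `Q`, hence the composite polynomial. -/
theorem PolyTime.comp {f g : BinTree → BinTree} (hf : PolyTime f) (hg : PolyTime g) :
    PolyTime fun x => f (g x) := by
  obtain ⟨p, P, hp, hP⟩ := hf
  obtain ⟨q, Q, hq, hQ⟩ := hg
  refine ⟨fun r => .seq (q r) (p r), Q + P.comp Q, fun r s => ?_, fun x => ?_⟩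
  · obtain ⟨t₁, s₁, h₁, e₁, k₁, b₁⟩ := hq r s
    obtain ⟨t₂, s₂, h₂, e₂, k₂, b₂⟩ := hp r s₁
    refine ⟨_, _, .seq h₁ h₂, by rw [e₂, e₁], fun i hi => by rw [k₂ i hi, k₁ i hi], ?_⟩
    rw [e₁] at b₂
    beta_reduce at b₁ b₂
    have := eval_mono P (hQ (s r))
    simp only [Polynomial.eval_add, Polynomial.eval_comp]
    omega
  · have := eval_mono P (hQ x)
    have := hP (g x)
    simp only [Polynomial.eval_add, Polynomial.eval_comp]
    omega

theorem PolyTime.hd {f : BinTree → BinTree} (hf : PolyTime f) : PolyTime fun x => (f x).hd :=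
  comp (f := BinTree.hd) (.of_term (fun r => .hd (.reg r)) 2 (fun _ _ => rfl) (fun _ => le_rfl)
    (fun x => (size_hd_le x).trans (by simp))) hf

theorem PolyTime.tl {f : BinTree → BinTree} (hf : PolyTime f) : PolyTime fun x => (f x).tl :=
  comp (f := BinTree.tl) (.of_term (fun r => .tl (.reg r)) 2 (fun _ _ => rfl) (fun _ => le_rfl)
    (fun x => (size_tl_le x).trans (by simp))) hf

theorem PolyTime.nth {f : BinTree → BinTree} (hf : PolyTime f) (j : ℕ) :
    PolyTime fun x => BinTree.nth j (f x) := by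
  induction j generalizing f with
  | zero => exact hf.hd
  | succ j ih => exact ih hf.tl

/-- A program placed at a register leaves all lower ones alone, so the input survives in `r` and the
first result in `r + 1` while later parts run further up. -/
theorem PolyTime.cons {f g : BinTree → BinTree} (hf : PolyTime f) (hg : PolyTime g) :
    PolyTime fun x => .cons (f x) (g x) := by
  obtain ⟨p, P, hp, hP⟩ := hf
  obtain ⟨q, Q, hq, hQ⟩ := hg
  refine ⟨fun r => .seq (.assign (r + 1) (.reg r)) (.seq (p (r + 1))
    (.seq (.assign (r + 2) (.reg r)) (.seq (q (r + 2))
      (.assign r (.cons (.reg (r + 1)) (.reg (r + 2))))))), P + Q + 8, fun r s => ?_, fun x => ?_⟩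
  · obtain ⟨t₁, s₁, h₁, e₁, k₁, b₁⟩ := hp (r + 1) (Function.update s (r + 1) (s r))
    obtain ⟨t₂, s₂, h₂, e₂, k₂, b₂⟩ := hq (r + 2) (Function.update s₁ (r + 2) (s₁ r))
    simp only [Function.update_self] at e₁ e₂ b₁ b₂
    have r₁ : s₁ r = s r := by
      rw [k₁ r (by omega), Function.update_of_ne (by omega)]
    have r₂ : s₂ (r + 1) = f (s r) := by
      rw [k₂ _ (by omega), Function.update_of_ne (by omega), e₁]
    refine ⟨_, _, .seq (.assign _ _ _) (.seq h₁ (.seq (.assign _ _ _) (.seq h₂ (.assign _ _ _)))),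
      ?_, fun i hi => ?_, ?_⟩
    · simp [Term.eval, r₂, e₂, r₁]
    · rw [Function.update_of_ne hi.ne, k₂ i (by omega), Function.update_of_ne (by omega),
        k₁ i (by omega), Function.update_of_ne (by omega)]
    · rw [r₁] at b₂
      simp [Term.cost]
      omega
  · have := hP x
    have := hQ x
    simp [size]
    omega

theorem PolyTime.ite_nil {c f g : BinTree → BinTree} (hc : PolyTime c) (hf : PolyTime f)
    (hg : PolyTime g) [∀ x, Decidable (c x = .nil)] :
    PolyTime fun x => if c x = .nil then f x else g x := by
  obtain ⟨o, O, ho, hO⟩ := hc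
  obtain ⟨p, P, hp, hP⟩ := hf
  obtain ⟨q, Q, hq, hQ⟩ := hg
  refine ⟨fun r => .seq (.assign (r + 1) (.reg r)) (.seq (o (r + 1))
    (.cond (.reg (r + 1)) (q r) (p r))), O + P + Q + 4, fun r s => ?_, fun x => ?_⟩
  · obtain ⟨t₁, s₁, h₁, e₁, k₁, b₁⟩ := ho (r + 1) (Function.update s (r + 1) (s r))
    simp only [Function.update_self] at e₁ b₁
    have r₁ : s₁ r = s r := by
      rw [k₁ r (by omega), Function.update_of_ne (by omega)]
    have k : ∀ i < r, s₁ i = s i := fun i hi => by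
      rw [k₁ i (by omega), Function.update_of_ne (by omega)]
    by_cases h : c (s r) = .nil
    · obtain ⟨t₂, s₂, h₂, e₂, k₂, b₂⟩ := hp r s₁
      refine ⟨_, _, .seq (.assign _ _ _) (.seq h₁ (.cond_false (by simp [Term.eval, e₁, h]) h₂)),
        by simp [h, e₂, r₁], fun i hi => by rw [k₂ i hi, k i hi], ?_⟩
      rw [r₁] at b₂
      beta_reduce at b₂
      simp [Term.cost]
      omega
    · obtain ⟨t₂, s₂, h₂, e₂, k₂, b₂⟩ := hq r s₁
      refine ⟨_, _, .seq (.assign _ _ _) (.seq h₁ (.cond_true (by simp [Term.eval, e₁, h]) h₂)),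
        by simp [h, e₂, r₁], fun i hi => by rw [k₂ i hi, k i hi], ?_⟩
      rw [r₁] at b₂
      beta_reduce at b₂
      simp [Term.cost]
      omega
  · have := hP x
    have := hQ x
    simp
    split <;> omega

/-- The loop that folds a list, in register `r + 1`, into the accumulator, in register `r + 2`. -/
def foldLoop (r : ℕ) (p : Program) : Program :=
  .loop (.reg (r + 1)) (.seq (.assign (r + 3) (.cons (.hd (.reg (r + 1)))
    (.cons (.reg (r + 2)) (.reg r)))) (.seq p
      (.seq (.assign (r + 2) (.reg (r + 3))) (.assign (r + 1) (.tl (.reg (r + 1)))))))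

/-- The invariant is that the accumulator plus `G` for each remaining entry fits into `M`. So every
call of the body has an input of size at most `m + M + x.size + 2`, the `2` counting the two pairs
that pack its arguments. One round costs 14 steps besides that call, and the last test costs 2. -/
theorem exec_foldLoop {r : ℕ} {p : Program} {g : BinTree → BinTree → BinTree → BinTree}
    {P : Polynomial ℕ}
    (hp : Computes p (r + 3) (fun e => g e.hd e.tl.hd e.tl.tl) fun x => P.eval x.size)
    {x : BinTree} {m M G : ℕ}
    (hG : ∀ a acc, a.size ≤ m → (g a acc x).size ≤ acc.size + G) (l : BinTree) (hl : l.size ≤ m)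
    (s : Store) (hs : s (r + 1) = l) (hx : s r = x) (hM : (s (r + 2)).size + l.len * G ≤ M) :
    ∃ (t : ℕ) (s' : Store), Exec (foldLoop r p) s t s' ∧ (∀ i ≤ r, s' i = s i) ∧
      s' (r + 2) = l.toList.foldl (fun acc a => g a acc x) (s (r + 2)) ∧
      (s' (r + 2)).size ≤ M ∧
      t ≤ l.len * (P.eval (m + M + x.size + 2) + 14) + 2 := by
  induction l generalizing s with
  | nil =>
    refine ⟨_, _, .loop_done (by simp [Term.eval, hs]), fun _ _ => rfl, rfl, ?_, ?_⟩
    · simpa [len, toList] using hM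
    · simp [Term.cost]
  | cons a b _ ih =>
    simp only [size, len, toList, List.length_cons] at hl hM
    have ha : a.size ≤ m := by omega
    have hacc : (s (r + 2)).size ≤ M := le_trans (Nat.le_add_right _ _) hM
    set s₁ := Function.update s (r + 3) (.cons a (.cons (s (r + 2)) x)) with hs₁
    obtain ⟨t₂, s₂, h₂, e₂, k₂, b₂⟩ := hp s₁
    have hb : t₂ ≤ P.eval (m + M + x.size + 2) := by
      refine b₂.trans (eval_mono P ?_)
      simp only [hs₁, Function.update_self, size]
      omega
    simp only [hs₁, Function.update_self, BinTree.hd, BinTree.tl] at e₂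
    have k : ∀ i ≤ r + 2, s₂ i = s i := fun i hi => by
      rw [k₂ i (by omega), hs₁, Function.update_of_ne (by omega)]
    set s₃ := Function.update s₂ (r + 2) (s₂ (r + 3)) with hs₃
    set s₄ := Function.update s₃ (r + 1) b with hs₄
    have h4a : s₄ (r + 2) = g a (s (r + 2)) x := by
      rw [hs₄, Function.update_of_ne (by omega), hs₃, Function.update_self, e₂]
    have h4b : ∀ i ≤ r, s₄ i = s i := fun i hi => by
      rw [hs₄, Function.update_of_ne (by omega), hs₃, Function.update_of_ne (by omega),
        k i (by omega)]
    obtain ⟨t₅, s₅, h₅, k₅, e₅, m₅, b₅⟩ := ih (by omega) s₄ (by simp [hs₄])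
      (by rw [h4b r le_rfl, hx]) (by
        rw [h4a]
        have := hG a (s (r + 2)) ha
        rw [Nat.succ_mul] at hM
        simp only [len]
        omega)
    have h3 : s₃ (r + 1) = .cons a b := by
      rw [hs₃, Function.update_of_ne (by omega), k _ (by omega), hs]
    have ex : Exec (foldLoop r p) s _ s₅ := .loop_step (by simp [Term.eval, hs])
      (.seq (.assign _ _ _) (.seq (s₁ := s₂) (t₁ := t₂) ?_ (.seq (.assign _ _ _) (.assign _ _ _))))
      (t₂ := t₅) ?_
    · refine ⟨_, _, ex, fun i hi => by rw [k₅ i hi, h4b i hi], ?_, m₅, ?_⟩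
      · rw [e₅, h4a]; rfl
      · simp only [Term.cost, len, toList, List.length_cons, Nat.succ_mul] at b₅ ⊢
        omega
    · simpa [Term.eval, hs, BinTree.hd, hx, hs₁] using h₂
    · have : (Term.tl (.reg (r + 1))).eval s₃ = b := by simp [Term.eval, h3, BinTree.tl]
      simp only [Term.eval] at this ⊢
      rw [← hs₃, this]
      exact h₅

/-- The growth per step must be additive, with an increment independent of the accumulator: a
polynomial bound in the accumulator could become exponential under iteration. -/
theorem PolyTime.foldl {f h : BinTree → BinTree} {g : BinTree → BinTree → BinTree → BinTree}
    (hf : PolyTime f) (hh : PolyTime h)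
    (hg : PolyTime fun e => g e.hd e.tl.hd e.tl.tl) (G : Polynomial ℕ)
    (hG : ∀ a acc x, (g a acc x).size ≤ acc.size + G.eval (a.size + x.size)) :
    PolyTime fun x => (f x).toList.foldl (fun acc a => g a acc x) (h x) := by
  obtain ⟨p, P, hp, hP⟩ := hf
  obtain ⟨q, Q, hq, hQ⟩ := hh
  obtain ⟨o, O, ho, -⟩ := hg
  set M : Polynomial ℕ := Q + P * G.comp (P + Polynomial.X) with hM
  set B : Polynomial ℕ := P * (O.comp (P + M + Polynomial.X + 2) + 14) with hB
  have main : ∀ r s, ∃ (t : ℕ) (s' : Store),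
      Exec (.seq (.assign (r + 1) (.reg r)) (.seq (p (r + 1))
        (.seq (.assign (r + 2) (.reg r)) (.seq (q (r + 2)) (.seq (foldLoop r (o (r + 3)))
          (.assign r (.reg (r + 2)))))))) s t s' ∧
      s' r = (f (s r)).toList.foldl (fun acc a => g a acc (s r)) (h (s r)) ∧
      (∀ i < r, s' i = s i) ∧ t ≤ (P + Q + B + 8).eval (s r).size ∧
      (s' r).size ≤ M.eval (s r).size := by
    intro r s
    obtain ⟨t₁, s₁, h₁, e₁, k₁, b₁⟩ := hp (r + 1) (Function.update s (r + 1) (s r))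
    obtain ⟨t₂, s₂, h₂, e₂, k₂, b₂⟩ := hq (r + 2) (Function.update s₁ (r + 2) (s₁ r))
    simp only [Function.update_self] at e₁ e₂ b₁ b₂
    have r₁ : s₁ r = s r := by
      rw [k₁ r (by omega), Function.update_of_ne (by omega)]
    have r₂ : s₂ (r + 1) = f (s r) := by
      rw [k₂ _ (by omega), Function.update_of_ne (by omega), e₁]
    have r₃ : ∀ i ≤ r, s₂ i = s i := fun i hi => by
      rw [k₂ _ (by omega), Function.update_of_ne (by omega), k₁ _ (by omega),
        Function.update_of_ne (by omega)]
    rw [r₁] at e₂ b₂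
    have hlen : (f (s r)).len ≤ P.eval (s r).size := (len_le_size _).trans (hP _)
    obtain ⟨t₃, s₃, h₃, k₃, e₃, m₃, b₃⟩ := exec_foldLoop (ho (r + 3)) (x := s r)
      (m := P.eval (s r).size) (M := M.eval (s r).size)
      (G := (G.comp (P + Polynomial.X)).eval (s r).size)
      (fun a acc ha => (hG a acc (s r)).trans (Nat.add_le_add_left (by
        rw [Polynomial.eval_comp]
        exact eval_mono G (by simpa using ha)) _)) (f (s r)) (hP _) s₂ r₂ (r₃ r le_rfl) (by
        rw [hM, Polynomial.eval_add, Polynomial.eval_mul, e₂]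
        exact Nat.add_le_add (hQ _) (Nat.mul_le_mul_right _ hlen))
    refine ⟨_, _, .seq (.assign _ _ _) (.seq h₁ (.seq (.assign _ _ _) (.seq h₂ (.seq h₃
      (.assign _ _ _))))), ?_, fun i hi => ?_, ?_, ?_⟩
    · simp only [Function.update_self, Term.eval]
      rw [e₃, e₂]
    · rw [Function.update_of_ne hi.ne, k₃ i hi.le, r₃ i hi.le]
    · have hb := b₃.trans (Nat.add_le_add_right (Nat.mul_le_mul_right _ hlen) 2)
      simp [Term.cost, hB] at hb ⊢
      omega
    · simpa [Term.eval] using m₃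
  refine ⟨_, P + Q + B + 8 + M, fun r s => (main r s).imp fun t => Exists.imp fun s' h =>
    ⟨h.1, h.2.1, h.2.2.1, h.2.2.2.1.trans ?_⟩, fun x => ?_⟩
  -- The size bound concerns the function only, so it is read off from a run on any store holding
  -- `x`.
  · obtain ⟨t, s', -, e, -, -, hm⟩ := main 0 fun _ => x
    rw [e] at hm
    rw [Polynomial.eval_add]
    exact hm.trans (Nat.le_add_left _ _)
  · beta_reduce
    rw [Polynomial.eval_add (q := M)]
    exact Nat.le_add_right _ _

/-! ### Predicates decidable in polynomial time -/

/-- `p` is decidable in polynomial time. -/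
def PolyDec (p : BinTree → Prop) : Prop := PolyTime fun x => ofProp (p x)

theorem PolyDec.congr {p q : BinTree → Prop} (hp : PolyDec p) (h : ∀ x, p x ↔ q x) : PolyDec q := by
  have : p = q := funext fun x => propext (h x)
  exact this ▸ hp

theorem PolyDec.comp {p : BinTree → Prop} {f : BinTree → BinTree} (hp : PolyDec p)
    (hf : PolyTime f) : PolyDec fun x => p (f x) :=
  PolyTime.comp (f := fun x => ofProp (p x)) hp hf

theorem PolyDec.ite {p : BinTree → Prop} [∀ x, Decidable (p x)] {f g : BinTree → BinTree}
    (hp : PolyDec p) (hf : PolyTime f) (hg : PolyTime g) :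
    PolyTime fun x => if p x then f x else g x := by
  classical
  have := PolyTime.ite_nil hp hg hf
  simpa only [ofProp_eq_nil, ite_not] using this

theorem PolyTime.polyDec_eq_nil {f : BinTree → BinTree} (hf : PolyTime f) :
    PolyDec fun x => f x = .nil := by
  classical
  exact PolyTime.ite_nil hf (.const (.cons .nil .nil)) (.const .nil)

theorem PolyDec.not {p : BinTree → Prop} (hp : PolyDec p) : PolyDec fun x => ¬ p x :=
  (PolyTime.polyDec_eq_nil hp).congr fun _ => ofProp_eq_nil

theorem PolyDec.true : PolyDec fun _ => True := PolyTime.const _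

theorem PolyDec.and {p q : BinTree → Prop} (hp : PolyDec p) (hq : PolyDec q) :
    PolyDec fun x => p x ∧ q x := by
  classical
  have := PolyDec.ite hp hq (.const .nil)
  refine (congrArg PolyTime (funext fun x => ?_)).mp this
  by_cases h : p x <;> simp [ofProp, h]

theorem PolyDec.or {p q : BinTree → Prop} (hp : PolyDec p) (hq : PolyDec q) :
    PolyDec fun x => p x ∨ q x :=
  (hp.not.and hq.not).not.congr fun x => by tauto

theorem PolyDec.forall_finite {ι : Type*} [Finite ι] {p : ι → BinTree → Prop}
    (hp : ∀ i, PolyDec (p i)) : PolyDec fun x => ∀ i, p i x := by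
  classical
  cases nonempty_fintype ι
  suffices ∀ S : Finset ι, PolyDec fun x => ∀ i ∈ S, p i x from
    (this Finset.univ).congr fun x => by simp
  intro S
  induction S using Finset.induction_on with
  | empty => exact PolyDec.true.congr fun x => by simp
  | insert i S _ ih => exact ((hp i).and ih).congr fun x => by simp

theorem PolyDec.exists_finite {ι : Type*} [Finite ι] {p : ι → BinTree → Prop}
    (hp : ∀ i, PolyDec (p i)) : PolyDec fun x => ∃ i, p i x :=
  (PolyDec.forall_finite fun i => (hp i).not).not.congr fun x => by simp

/-- The accumulator of the fold is a flag, which stays `nil` after the first failure. -/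
theorem PolyDec.forall_mem {f : BinTree → BinTree} {p : BinTree → BinTree → Prop}
    (hf : PolyTime f) (hp : PolyDec fun e => p e.hd e.tl) :
    PolyDec fun x => ∀ a ∈ (f x).toList, p a x := by
  classical
  have := PolyTime.foldl (g := fun a acc x => if acc = .nil then .nil else ofProp (p a x)) hf
    (.const (.cons .nil .nil)) (.ite_nil PolyTime.id.tl.hd (.const _)
      (hp.comp (PolyTime.id.hd.cons PolyTime.id.tl.tl))) 1 (fun a acc x => by
        have := size_ofProp_le (p a x)
        split
        · simp [size]
        · simp
          omega)
  refine (congrArg PolyTime (funext fun x => ?_)).mp this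
  have nil : ∀ l : List BinTree, l.foldl (fun acc a => if acc = .nil then .nil
      else ofProp (p a x)) .nil = .nil := fun l => by
    induction l with
    | nil => rfl
    | cons a l ih => simpa using ih
  beta_reduce
  generalize (f x).toList = l
  induction l with
  | nil => simp [ofProp]
  | cons a l ih =>
    by_cases h : p a x
    · rw [List.foldl_cons, if_neg (by simp), ofProp_true h, ih]
      simp [h]
    · rw [List.foldl_cons, if_neg (by simp), ofProp_false h, nil]
      simp [ofProp, h]

/-- One entry of `f x` is dropped for each entry of `g x`; the comparison holds when nothing is
left. Variables are coded in unary, so this also tests their equality. -/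
theorem PolyTime.polyDec_len_le {f g : BinTree → BinTree} (hf : PolyTime f) (hg : PolyTime g) :
    PolyDec fun x => (f x).len ≤ (g x).len := by
  have := PolyTime.foldl (g := fun _ acc _ => acc.tl) hg hf PolyTime.id.tl.hd.tl 0
    (fun _ acc _ => by simpa using size_tl_le acc)
  refine this.polyDec_eq_nil.congr fun x => ?_
  rw [← len_eq_zero]
  suffices ∀ (l : List BinTree) (t : BinTree), (l.foldl (fun acc _ => acc.tl) t).len = t.len - l.length by
    rw [this, Nat.sub_eq_zero_iff_le]; rfl
  intro l
  induction l with
  | nil => simp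
  | cons a l ih => intro t; simp [ih, len_tl]; omega

theorem PolyTime.polyDec_len_eq {f g : BinTree → BinTree} (hf : PolyTime f) (hg : PolyTime g) :
    PolyDec fun x => (f x).len = (g x).len :=
  ((hf.polyDec_len_le hg).and (hg.polyDec_len_le hf)).congr fun _ => Nat.le_antisymm_iff.symm

theorem PolyTime.ofList_ofFn {k : ℕ} {f : Fin k → BinTree → BinTree} (hf : ∀ j, PolyTime (f j)) :
    PolyTime fun x => ofList (List.ofFn fun j => f j x) := by
  induction k with
  | zero => exact .const .nil
  | succ k ih => simpa only [List.ofFn_succ, ofList] using (hf 0).cons (ih fun j => hf j.succ)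

/-- Collecting, in an accumulator without repetitions with respect to `E`, the values `u c x` for
the elements `c` with `q c x` of a list. -/
noncomputable def collect (E : BinTree → BinTree → Prop) (q : BinTree → BinTree → Prop)
    (u : BinTree → BinTree → BinTree) (x acc : BinTree) (l : List BinTree) : BinTree := by
  classical exact l.foldl (fun acc c =>
    if q c x ∧ ∀ z ∈ acc.toList, ¬ E (u c x) z then .cons (u c x) acc else acc) acc

theorem PolyTime.collect {E q : BinTree → BinTree → Prop} {u : BinTree → BinTree → BinTree}
    {f h : BinTree → BinTree} (hE : PolyDec fun e => E e.hd e.tl) (hq : PolyDec fun e => q e.hd e.tl)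
    (hu : PolyTime fun e => u e.hd e.tl) (hf : PolyTime f) (hh : PolyTime h) :
    PolyTime fun x => CSP.collect E q u x (h x) (f x).toList := by
  classical
  -- The fold passes the entry, the accumulator and the input; `q` and `u` need only the first and
  -- the last.
  have henv : PolyTime fun e => BinTree.cons e.hd e.tl.tl := PolyTime.id.hd.cons PolyTime.id.tl.tl
  have hu' : PolyTime fun e => u e.hd e.tl.tl := hu.comp henv
  obtain ⟨-, U, -, hU⟩ := hu
  refine PolyTime.foldl hf hh (PolyDec.ite (p := fun e => q e.hd e.tl.tl ∧
    ∀ z ∈ e.tl.hd.toList, ¬ E (u e.hd e.tl.tl) z) ((hq.comp henv).and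
      (PolyDec.forall_mem (p := fun z e => ¬ E (u e.hd e.tl.tl) z) PolyTime.id.tl.hd
        (hE.comp (f := fun e => .cons (u e.tl.hd e.tl.tl.tl) e.hd)
          ((hu'.comp PolyTime.id.tl).cons PolyTime.id.hd)).not))
    (hu'.cons PolyTime.id.tl.hd) PolyTime.id.tl.hd)
    (U.comp (Polynomial.X + 1) + 1) fun a acc x => ?_
  have := hU (.cons a x)
  simp only [BinTree.hd, BinTree.tl, size] at this
  split
  · simp [size]
    omega
  · simp

/-! ### Encodings have polynomial size, and polynomials grow subexponentially -/

theorem size_ofList_le {l : List BinTree} {m : ℕ} (h : ∀ a ∈ l, a.size ≤ m) :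
    (ofList l).size ≤ l.length * (m + 1) := by
  induction l with
  | nil => simp [ofList, size]
  | cons a l ih =>
    have h₁ := h a (by simp)
    have h₂ := ih fun b hb => h b (by simp [hb])
    simp only [ofList, size, List.length_cons, Nat.succ_mul]
    omega

theorem size_ofNat (n : ℕ) : (ofNat n).size = n := by
  induction n with
  | zero => rfl
  | succ n ih => simpa [ofNat, ofList, size, List.replicate_succ] using ih

variable {D : Type*}

theorem exists_length_constraints_le {Γ : Set (Rel D)} (hΓ : Γ.Finite) :
    ∃ C A : ℕ, (∀ r ∈ Γ, r.arity ≤ A) ∧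
      ∀ I : Instance Γ, I.constraints.length ≤ C * (I.numVars + 1) ^ A := by
  classical
  have := hΓ.fintype
  obtain ⟨A, hA⟩ := (hΓ.image Rel.arity).bddAbove
  have hA' : ∀ r ∈ Γ, r.arity ≤ A := fun r hr => hA ⟨r, hr, rfl⟩
  refine ⟨Fintype.card Γ, A, hA', fun I => ?_⟩
  -- Scopes are padded with `none` to the common length `A`, so constraints embed into a type with
  -- `|Γ| * (n + 1) ^ A` elements.
  let φ : Constraint Γ I.numVars → Γ × (Fin A → Option (Fin I.numVars)) := fun c =>
    (⟨c.rel, c.rel_mem⟩, fun i => if h : i.1 < c.rel.arity then some (c.scope ⟨i, h⟩) else none)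
  have hφ : Function.Injective φ := by
    rintro ⟨r, hr, w⟩ ⟨r', hr', w'⟩ h
    obtain ⟨h₁, h₂⟩ := Prod.mk.inj h
    obtain rfl : r = r' := congrArg Subtype.val h₁
    congr
    funext j
    have := congrFun h₂ ⟨j, j.2.trans_le (hA' _ hr)⟩
    simpa using this
  have := ((List.nodup_map_iff hφ).mpr I.nodup).length_le_card
  simpa using this

/-- Converts time polynomial in the input size into time polynomial in the number of variables, the
parameter of `T`. -/
theorem exists_size_encode_le {Γ : Set (Rel D)} (hΓ : Γ.Finite) (name : Rel D → BinTree) :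
    ∃ P : Polynomial ℕ, ∀ I : Instance Γ, (I.encode name).size ≤ P.eval I.numVars := by
  obtain ⟨C, A, hA, hC⟩ := exists_length_constraints_le hΓ
  obtain ⟨B, hB⟩ := (hΓ.image fun r => (name r).size).bddAbove
  refine ⟨Polynomial.X + (C : Polynomial ℕ) * (Polynomial.X + 1) ^ A *
    ((B : Polynomial ℕ) + (A : Polynomial ℕ) * (Polynomial.X + 1) + 2) + 1, fun I => ?_⟩
  have hc : ∀ a ∈ I.constraints.map fun c => c.encode name,
      a.size ≤ B + A * (I.numVars + 1) + 1 := by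
    intro a ha
    obtain ⟨c, -, rfl⟩ := List.mem_map.mp ha
    have h₁ : (name c.rel).size ≤ B := hB ⟨_, c.rel_mem, rfl⟩
    have h₂ := size_ofList_le (l := List.ofFn fun j => ofNat (c.scope j)) (m := I.numVars)
      fun a ha => by
        obtain ⟨j, rfl⟩ := (List.mem_ofFn' _ _).mp ha
        simp [size_ofNat, (c.scope j).2.le]
    rw [List.length_ofFn] at h₂
    have h₃ := Nat.mul_le_mul_right (I.numVars + 1) (hA _ c.rel_mem)
    simp only [Constraint.encode, size]
    omega
  have h₁ := size_ofList_le hc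
  rw [List.length_map] at h₁
  have h₂ := Nat.mul_le_mul_right (B + A * (I.numVars + 1) + 1 + 1) (hC I)
  simp only [Instance.encode, size, size_ofNat]
  simp
  ring_nf at h₁ h₂ ⊢
  omega

theorem exists_eval_le_two_rpow (P : Polynomial ℕ) {ε : ℝ} (hε : 0 < ε) :
    ∃ K : ℕ, ∀ n : ℕ, ((P.eval n : ℕ) : ℝ) ≤ K * (2 : ℝ) ^ (ε * n) := by
  have hpow : ∀ x : ℕ, (2 : ℝ) ^ (ε * x) = ((2 : ℝ) ^ ε) ^ x := fun x =>
    Real.rpow_mul_natCast (by norm_num) ε x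
  induction P using Polynomial.induction_on' with
  | add p q hp hq =>
    obtain ⟨K, hK⟩ := hp
    obtain ⟨L, hL⟩ := hq
    refine ⟨K + L, fun n => ?_⟩
    push_cast [Polynomial.eval_add]
    linarith [hK n, hL n]
  | monomial k a =>
    have hr : (1 : ℝ) < (2 : ℝ) ^ ε := Real.one_lt_rpow (by norm_num) hε
    obtain ⟨C, -, hC⟩ := Asymptotics.bound_of_isBigO_nat_atTop
      (isLittleO_pow_const_const_pow_of_one_lt (R := ℝ) k hr).isBigO
    refine ⟨a * ⌈C⌉₊, fun n => ?_⟩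
    have h := hC (x := n) (by positivity)
    rw [Real.norm_of_nonneg (by positivity), Real.norm_of_nonneg (by positivity)] at h
    rw [hpow]
    push_cast [Polynomial.eval_monomial]
    rw [mul_assoc]
    gcongr
    exact h.trans (by gcongr; exact Nat.le_ceil C)

/-! ### Running a program after a reduction -/

/-- The number of an initial segment of the registers to which alone the program assigns. -/
def Program.numRegs : Program → ℕ
  | .assign i _ => i + 1
  | .seq p q => max p.numRegs q.numRegs
  | .cond _ p q => max p.numRegs q.numRegs
  | .loop _ p => p.numRegs

/-- Guarantees that a program leaves only finitely many registers to be cleaned up. -/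
theorem Exec.eq_of_numRegs_le {p : Program} {s s' : Store} {t : ℕ} (h : Exec p s t s') {i : ℕ}
    (hi : p.numRegs ≤ i) : s' i = s i := by
  induction h with
  | assign j e s =>
    rw [Function.update_of_ne]
    simp only [Program.numRegs] at hi
    omega
  | seq _ _ ih ih' =>
    simp only [Program.numRegs, max_le_iff] at hi
    rw [ih' hi.2, ih hi.1]
  | cond_true _ _ ih => exact ih (le_of_max_le_left hi)
  | cond_false _ _ ih => exact ih (le_of_max_le_right hi)
  | loop_done _ => rfl
  | loop_step _ _ _ ih ih' => rw [ih' hi, ih hi]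

/-- Empties the registers `1, …, m + 1`. -/
def clearRegs : ℕ → Program
  | 0 => .assign 1 .nil
  | m + 1 => .seq (.assign (m + 2) .nil) (clearRegs m)

/-- The given solver is specified only on stores that are empty outside register `0`, so the traces
of the reduction must be erased before it runs. -/
theorem exec_clearRegs (m : ℕ) (s : Store) : ∃ s', Exec (clearRegs m) s (2 * (m + 1)) s' ∧
    s' 0 = s 0 ∧ ∀ i ≠ 0, (m + 1 < i → s i = .nil) → s' i = .nil := by
  induction m generalizing s with
  | zero =>
    refine ⟨_, .assign _ _ _, by simp, fun i h₀ h => ?_⟩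
    by_cases hi : i = 1
    · simp [hi, Term.eval]
    · rw [Function.update_of_ne hi]
      exact h (by omega)
  | succ m ih =>
    obtain ⟨s', h, e, k⟩ := ih (Function.update s (m + 2) .nil)
    refine ⟨s', ?_, by simpa using e, fun i h₀ hi => k i h₀ fun hm => ?_⟩
    · have := Exec.seq (.assign (m + 2) .nil s) h
      rwa [show (Term.nil.cost + 1 + 2 * (m + 1)) = 2 * (m + 1 + 1) by simp [Term.cost]; ring] at this
    · by_cases h : i = m + 2
      · simp [h]
      · rw [Function.update_of_ne h]
        exact hi (by omega)

/-- A polynomial-time reduction that does not increase the number of variables, together with a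
polynomial-time check that may reject the instance, transfers running times up to an arbitrarily
small increase of the exponent. -/
theorem SolvableInTime.of_reduction {Γ Δ : Set (Rel D)} (hΔ : Δ.Finite) {c : ℝ≥0}
    (h : SolvableInTime Γ c)
    (hred : ∀ name : Rel D → BinTree, ∃ (name' : Rel D → BinTree) (q : BinTree → Prop)
      (f : BinTree → BinTree), Set.InjOn name' Δ ∧ PolyDec q ∧ PolyTime f ∧
      ∀ I : Instance Δ, (¬ q (I.encode name') → ¬ I.Satisfiable) ∧
        (q (I.encode name') → ∃ J : Instance Γ, J.encode name = f (I.encode name') ∧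
          J.numVars = I.numVars ∧ (J.Satisfiable ↔ I.Satisfiable)))
    {ε : ℝ≥0} (hε : 0 < ε) : SolvableInTime Δ (c + ε) := by
  classical
  obtain ⟨name, -, p, K, hp⟩ := h
  obtain ⟨name', q, f, hname', hq, hf, hred⟩ := hred name
  obtain ⟨S, hS⟩ := exists_size_encode_le hΔ name'
  -- Check and translation are one function: `nil` means rejection, and the extra pair marks
  -- acceptance whatever `f x` is.
  obtain ⟨o, O, ho, -⟩ : PolyTime fun x => if q x then .cons .nil (f x) else .nil :=
    hq.ite ((PolyTime.const .nil).cons hf) (.const .nil)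
  set m := (o 0).numRegs
  -- Clearing takes `2 * (m + 1)` steps, and `7` is ample for the test and the assignment.
  obtain ⟨L, hL⟩ := exists_eval_le_two_rpow (O.comp S + ((2 * (m + 1) + 7 : ℕ) : Polynomial ℕ))
    (ε := ε) (by exact_mod_cast hε)
  refine ⟨name', hname', .seq (o 0) (.cond (.reg 0) (.seq (.assign 0 (.tl (.reg 0)))
    (.seq (clearRegs m) p)) (.assign 0 .nil)), L + K, fun I => ?_⟩
  set x := I.encode name' with hx
  obtain ⟨t₁, s₁, h₁, e₁, -, b₁⟩ := ho 0 (inputStore x)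
  have hb₁ : t₁ + (2 * (m + 1) + 7) ≤
      (O.comp S + ((2 * (m + 1) + 7 : ℕ) : Polynomial ℕ)).eval I.numVars := by
    simp only [Polynomial.eval_add, Polynomial.eval_comp, Polynomial.eval_natCast, Nat.cast_id]
    exact Nat.add_le_add_right (b₁.trans (eval_mono O (hS I))) _
  have hb₂ : (t₁ : ℝ) + (2 * (m + 1) + 7) ≤ L * (2 : ℝ) ^ (((c + ε : ℝ≥0) : ℝ) * I.numVars) := by
    have hb : ((t₁ + (2 * (m + 1) + 7) : ℕ) : ℝ) ≤ _ := (Nat.cast_le.mpr hb₁).trans (hL _)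
    push_cast at hb ⊢
    refine hb.trans ?_
    gcongr
    · norm_num
    · simp
  by_cases hqx : q x
  · obtain ⟨J, hJ, hn, hsat⟩ := (hred I).2 hqx
    have e₁' : s₁ 0 = .cons .nil (f x) := by rw [e₁]; simp [inputStore, hqx]
    obtain ⟨s₂, h₂, e₂, k₂⟩ := exec_clearRegs m (Function.update s₁ 0 (f x))
    have hs₂ : s₂ = inputStore (J.encode name) := by
      funext i
      by_cases hi : i = 0
      · simp [hi, e₂, inputStore, hJ, hx]
      · rw [inputStore, Function.update_of_ne hi]
        refine k₂ i hi fun hm => ?_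
        rw [Function.update_of_ne hi, h₁.eq_of_numRegs_le (by omega), inputStore,
          Function.update_of_ne hi]
    obtain ⟨t₃, s₃, h₃, a₃, b₃⟩ := hp J
    rw [← hs₂] at h₃
    refine ⟨_, s₃, .seq h₁ (.cond_true (by simp [Term.eval, e₁']) (.seq (.assign _ _ _)
      (.seq (s₁ := s₂) (t₁ := 2 * (m + 1)) ?_ h₃))), a₃.trans hsat, ?_⟩
    · simpa [Term.eval, e₁', BinTree.tl] using h₂
    · have hK : (K : ℝ) * (2 : ℝ) ^ ((c : ℝ) * J.numVars) ≤
          K * (2 : ℝ) ^ (((c + ε : ℝ≥0) : ℝ) * I.numVars) := by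
        rw [hn]
        gcongr
        · norm_num
        · simp
      push_cast [Term.cost] at hb₂ hK ⊢
      linarith
  · have e₁' : s₁ 0 = .nil := by rw [e₁]; simp [inputStore, hqx]
    refine ⟨_, _, .seq h₁ (.cond_false (by simp [Term.eval, e₁']) (.assign _ _ _)), ?_, ?_⟩
    · simpa [Term.eval] using (hred I).1 hqx
    · have hK : 0 ≤ (K : ℝ) * (2 : ℝ) ^ (((c + ε : ℝ≥0) : ℝ) * I.numVars) := by positivity
      push_cast [Term.cost] at hb₂ hK ⊢
      linarith

/-- An instance over the smaller language has literally the same encoding over the larger one, so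
the same program works. -/
theorem SolvableInTime.mono {Γ Δ : Set (Rel D)} (hΓ : Γ ⊆ Δ) {c : ℝ≥0} (h : SolvableInTime Δ c) :
    SolvableInTime Γ c := by
  obtain ⟨name, hname, p, K, hp⟩ := h
  refine ⟨name, hname.mono hΓ, p, K, fun I => ?_⟩
  let φ : Constraint Γ I.numVars → Constraint Δ I.numVars := fun c => ⟨c.rel, hΓ c.rel_mem, c.scope⟩
  have hφ : Function.Injective φ := by
    rintro ⟨r, hr, w⟩ ⟨r', hr', w'⟩ h
    cases h
    rfl
  have := hp ⟨I.numVars, I.constraints.map φ, (List.nodup_map_iff hφ).mpr I.nodup⟩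
  simpa [Instance.encode, Instance.Satisfiable, Function.comp_def, Constraint.encode, φ] using this

theorem T_mono {Γ Δ : Set (Rel D)} (h : Γ ⊆ Δ) : T Γ ≤ T Δ :=
  iInf_mono fun _ => iInf_mono' fun hc => ⟨hc.mono h, le_rfl⟩

theorem T_le_of_forall_pos {Γ Δ : Set (Rel D)}
    (h : ∀ c ε : ℝ≥0, SolvableInTime Γ c → 0 < ε → SolvableInTime Δ (c + ε)) : T Δ ≤ T Γ := by
  refine le_iInf₂ fun c hc => ENNReal.le_of_forall_pos_le_add fun ε hε _ => ?_
  exact (iInf₂_le (c + ε) (h c ε hc hε)).trans_eq (by push_cast; rfl)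

/-! ### Eliminating unary constraints -/

section Semantics

variable {D ι : Type*} {k : ℕ}

/-- The relation consisting of the tuples `t i`. -/
def relOf (t : ι → Fin k → D) : Rel D := ⟨k, Set.range t⟩

/-- The constraint by the relation `relOf t` with the scope `w`. -/
def applyTo {Γ : Set (Rel D)} {t : ι → Fin k → D} (h : relOf t ∈ Γ) {n : ℕ} (w : Fin k → Fin n) :
    Constraint Γ n :=
  ⟨relOf t, h, w⟩

theorem applyTo_injective {Γ : Set (Rel D)} {t : ι → Fin k → D} (h : relOf t ∈ Γ) (n : ℕ) :
    Function.Injective (applyTo (n := n) h) := fun w w' e => by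
  unfold applyTo at e
  cases e
  rfl

theorem relOf_mem (t : ι → Fin k → D) : relOf t ∈ ({relOf t} ∪ allUnary D : Set (Rel D)) :=
  Or.inl rfl

/-- The value `d` at the variable `v` satisfies all constraints of `I` by relations other
than `R`. -/
def Instance.Admissible {Γ : Set (Rel D)} (I : Instance Γ) (R : Rel D) (d : D)
    (v : Fin I.numVars) : Prop :=
  ∀ c ∈ I.constraints, c.rel ≠ R → ∀ j, c.scope j = v → (fun _ => d) ∈ c.rel.tuples

/-- The scopes of the constraints of `I` by the relation `relOf t`. -/
def Instance.scopes {t : ι → Fin k → D} (I : Instance ({relOf t} ∪ allUnary D)) :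
    Set (Fin k → Fin I.numVars) :=
  {w | applyTo (relOf_mem t) w ∈ I.constraints}

/-- The reason for passing from the scope `w` to `w ∘ τ o`: none is needed for `o = none`, and
for `o = some i` it is that the tuple `t i` is inadmissible. -/
def Instance.Applies {t : ι → Fin k → D} (I : Instance ({relOf t} ∪ allUnary D))
    (w : Fin k → Fin I.numVars) : Option ι → Prop
  | none => True
  | some i => ¬ ∀ j, I.Admissible (relOf t) (t i j) (w j)

/-- `σ` sends a column to one that differs from it at most in row `i`, where it has a fixed entry
`d`. Row `i` becomes constant, whereas each `t i'` also takes a value `d' ≠ d`. On a one-element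
domain nothing can be excluded. -/
theorem exists_excluding {t : ι → Fin k → D} (ht : ∀ d : ι → D, ∃ j, ∀ i, t i j = d i) (i : ι) :
    ∃ σ : Fin k → Fin k, (∀ i' ≠ i, t i' ∘ σ = t i') ∧ (Nontrivial D → t i ∘ σ ∉ Set.range t) := by
  classical
  rcases subsingleton_or_nontrivial D with hD | hD
  · exact ⟨id, fun _ _ => rfl, fun h => (not_nontrivial D h).elim⟩
  · obtain ⟨d, d', hd⟩ := exists_pair_ne D
    choose σ hσ using fun j => ht (Function.update (fun i' => t i' j) i d)
    refine ⟨σ, fun i' hi' => funext fun j => ?_, ?_⟩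
    · simp [hσ, hi']
    · rintro - ⟨i', hi'⟩
      obtain ⟨j, hj⟩ := ht fun _ => d'
      have := congrFun hi' j
      rw [hj, Function.comp_apply, hσ, Function.update_self] at this
      exact hd this.symm

/-- Such a constraint is unary. Phrasing this with constant tuples avoids transport along the
equation for its arity. -/
theorem Constraint.const_mem_of_mem {R : Rel D} {n : ℕ} {c : Constraint ({R} ∪ allUnary D) n}
    (hc : c.rel ≠ R) (f : Fin n → D) :
    (fun j => f (c.scope j)) ∈ c.rel.tuples ↔ ∀ j, (fun _ => f (c.scope j)) ∈ c.rel.tuples := by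
  obtain ⟨r, hr, w⟩ := c
  obtain ⟨E, rfl⟩ := hr.resolve_left hc
  simp only [unaryRel]
  exact ⟨fun h j => by rwa [Subsingleton.elim (α := Fin 1) j 0], fun h => h 0⟩

/-- A solution realises an admissible tuple on each scope, and the reindexings applied there fix
that tuple. Conversely, if `g` realised an inadmissible `t i`, the added constraint would put `t i ∘
τ (some i)` into the relation. -/
theorem Instance.satisfiable_iff {t : ι → Fin k → D} {τ : Option ι → Fin k → Fin k}
    (hτ : τ none = id) (hτ₁ : ∀ i, ∀ i' ≠ i, t i' ∘ τ (some i) = t i')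
    (hτ₂ : Nontrivial D → ∀ i, t i ∘ τ (some i) ∉ Set.range t)
    (I : Instance ({relOf t} ∪ allUnary D)) :
    I.Satisfiable ↔
      (∀ c ∈ I.constraints, c.rel ≠ relOf t → ∀ j, ∃ d, I.Admissible (relOf t) d (c.scope j)) ∧
      ∃ g : Fin I.numVars → D, ∀ o, ∀ w ∈ I.scopes, I.Applies w o →
        (fun j => g (w (τ o j))) ∈ Set.range t := by
  classical
  constructor
  · rintro ⟨f, hf⟩
    have hadm : ∀ v, I.Admissible (relOf t) (f v) v := by
      rintro _ c hc hR j rfl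
      exact (Constraint.const_mem_of_mem hR f).mp (hf c hc) j
    refine ⟨fun c hc hR j => ⟨_, hadm _⟩, f, fun o w hw ho => ?_⟩
    obtain ⟨i₀, hi₀⟩ : (fun j => f (w j)) ∈ Set.range t := hf _ hw
    refine ⟨i₀, ?_⟩
    cases o with
    | none => rw [hτ]; exact hi₀
    | some i =>
      have hi : i₀ ≠ i := by
        rintro rfl
        exact ho fun j => by rw [hi₀]; exact hadm _
      rw [← hτ₁ i i₀ hi, hi₀]
      rfl
  · rintro ⟨h, g, hg⟩
    have key : ∀ w ∈ I.scopes, ∀ j, I.Admissible (relOf t) (g (w j)) (w j) := by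
      intro w hw
      obtain ⟨i, hi⟩ := hg none w hw trivial
      rw [hτ] at hi
      have hi' : ∀ j, g (w j) = t i j := fun j => (congrFun hi j).symm
      simp only [hi']
      by_contra hbad
      -- With only one value available, the first condition already makes it admissible.
      rcases subsingleton_or_nontrivial D with hD | hD
      · refine hbad fun j c hc hR j' hj' => ?_
        obtain ⟨d, hd⟩ := h c hc hR j'
        rw [Subsingleton.elim (t i j) d]
        exact hd c hc hR j' rfl
      · refine hτ₂ hD i ?_
        rw [hi]
        exact hg (some i) w hw hbad
    -- `g` is repaired where its value is inadmissible; by `key` this never touches a variable in a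
    -- scope.
    let f : Fin I.numVars → D := fun v =>
      if h : ¬ I.Admissible (relOf t) (g v) v ∧ ∃ d, I.Admissible (relOf t) d v then h.2.choose
      else g v
    have hf : ∀ v, (∃ d, I.Admissible (relOf t) d v) → I.Admissible (relOf t) (f v) v := by
      intro v hv
      by_cases hgv : I.Admissible (relOf t) (g v) v
      · simp only [f]
        rwa [dif_neg fun h => h.1 hgv]
      · simp only [f]
        rw [dif_pos ⟨hgv, hv⟩]
        exact hv.choose_spec
    refine ⟨f, fun c hc => ?_⟩
    by_cases hR : c.rel = relOf t
    · obtain ⟨r, hr, w⟩ := c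
      subst hR
      have := hg none w hc trivial
      rw [hτ] at this
      have hfg : (fun j => f (w j)) = fun j => g (w j) :=
        funext fun j => dif_neg fun h => h.1 (key w hc j)
      exact (congrArg (· ∈ Set.range t) hfg).mpr this
    · exact (Constraint.const_mem_of_mem hR f).mpr fun j =>
        hf _ (h c hc hR j) c hc hR j rfl

end Semantics

/-! ### The reduction on encodings -/

/-- `E` decides equality on codes, so collecting keeps the list free of repetitions, as the
definition of an instance demands. -/
theorem exists_collect_eq {α : Type*} {code : α → BinTree} {E q : BinTree → BinTree → Prop}
    {u : BinTree → BinTree → BinTree} {x : BinTree}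
    (hE : ∀ w w', E (code w) (code w') ↔ w = w') {l : List BinTree}
    (hu : ∀ c ∈ l, q c x → ∃ w, u c x = code w) {W : List α} (hW : W.Nodup) :
    ∃ W' : List α, W'.Nodup ∧ collect E q u x (ofList (W.map code)) l = ofList (W'.map code) ∧
      ∀ w, w ∈ W' ↔ w ∈ W ∨ ∃ c ∈ l, q c x ∧ u c x = code w := by
  classical
  have hcode : Function.Injective code := fun w w' h => (hE w w').mp (h ▸ (hE w w).mpr rfl)
  induction l generalizing W with
  | nil => exact ⟨W, hW, rfl, by simp⟩
  | cons c l ih =>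
    have hu' := fun c hc => hu c (List.mem_cons_of_mem _ hc)
    simp only [collect, List.foldl_cons] at ih ⊢
    by_cases hq : q c x
    · obtain ⟨w₀, hw₀⟩ := hu c List.mem_cons_self hq
      -- With this reading of the guard, one step of the fold is `List.insert`.
      have hiff : (q c x ∧ ∀ z ∈ (ofList (W.map code)).toList, ¬ E (u c x) z) ↔ w₀ ∉ W := by
        simp [hq, hw₀, hE]
        exact ⟨fun h h' => h _ h' rfl, fun h w hw e => h (e ▸ hw)⟩
      obtain ⟨W', h₁, h₂, h₃⟩ := ih hu' (hW.insert (a := w₀))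
      refine ⟨W', h₁, ?_, fun w => ?_⟩
      · rw [← h₂]
        congr 1
        simp only [hiff]
        by_cases hm : w₀ ∈ W
        · simp [hm]
        · simp [hm, hw₀, ofList]
      · rw [h₃]
        simp only [List.mem_insert_iff, List.mem_cons, exists_eq_or_imp, hq, true_and, hw₀,
          hcode.eq_iff, eq_comm (a := w)]
        tauto
    · obtain ⟨W', h₁, h₂, h₃⟩ := ih hu' hW
      refine ⟨W', h₁, ?_, fun w => ?_⟩
      · simpa [hq] using h₂
      · simp [h₃, hq]

/-! ### Polynomial-time tests and rewriting on encoded instances -/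

section Trees

variable {D ι : Type*} {k : ℕ}

theorem toList_encode {Γ : Set (Rel D)} (name : Rel D → BinTree) (I : Instance Γ) :
    (I.encode name).tl.toList = I.constraints.map fun c => c.encode name := by
  simp [Instance.encode, BinTree.tl]

theorem nth_encode_applyTo {t : ι → Fin k → D} {Γ : Set (Rel D)} (h : relOf t ∈ Γ)
    {n : ℕ} (name : Rel D → BinTree) (w : Fin k → Fin n) (j : Fin k) : nth j ((applyTo h w).encode name).tl = ofNat (w j) :=
  nth_ofList_ofFn (fun j => ofNat (w j)) j

variable [Fintype D]

/-- A naming of the relations that shows which constants satisfy them. -/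
noncomputable def tableName (R r : Rel D) : BinTree := by
  classical exact if r = R then .nil else
    BinTree.cons .nil (ofList (List.ofFn fun i =>
      ofProp ((fun _ => (Fintype.equivFin D).symm i) ∈ r.tuples)))

theorem tableName_eq_nil {R r : Rel D} : tableName R r = .nil ↔ r = R := by
  unfold tableName
  split <;> simp_all

theorem nth_tableName {R r : Rel D} (h : r ≠ R) (d : D) :
    nth (Fintype.equivFin D d) (tableName R r).tl ≠ .nil ↔ (fun _ => d) ∈ r.tuples := by
  simp [tableName, h, BinTree.tl, nth_ofList_ofFn]

/-- Only `R` is named `nil`, and a unary relation is determined by the constants satisfying it. -/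
theorem tableName_injOn (R : Rel D) : Set.InjOn (tableName R) ({R} ∪ allUnary D) := by
  intro r hr r' hr' h
  by_cases e : r = R
  · rw [tableName_eq_nil.mpr e, eq_comm, tableName_eq_nil] at h
    rw [e, h]
  · have e' : r' ≠ R := fun e' => e (tableName_eq_nil.mp (h.trans (tableName_eq_nil.mpr e')))
    obtain ⟨E, rfl⟩ := hr.resolve_left e
    obtain ⟨E', rfl⟩ := hr'.resolve_left e'
    congr 1
    ext d
    have h₁ := nth_tableName e d
    rw [h, nth_tableName e' d] at h₁
    exact h₁.symm

/-- `Instance.Admissible` on encodings: `v` is a variable, `L` the list of constraints. -/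
def TreeAdmissible (d : D) (v L : BinTree) : Prop :=
  ∀ c ∈ L.toList, c.hd = .nil ∨ c.tl.hd.len ≠ v.len ∨ nth (Fintype.equivFin D d) c.hd.tl ≠ .nil

theorem polyDec_treeAdmissible {f g : BinTree → BinTree} (hf : PolyTime f) (hg : PolyTime g)
    (d : D) : PolyDec fun x => TreeAdmissible d (f x) (g x) :=
  PolyDec.forall_mem (p := fun c x => c.hd = .nil ∨ c.tl.hd.len ≠ (f x).len ∨
      nth (Fintype.equivFin D d) c.hd.tl ≠ .nil) hg
    (PolyTime.id.hd.hd.polyDec_eq_nil.or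
      ((PolyTime.id.hd.tl.hd.polyDec_len_eq (hf.comp PolyTime.id.tl)).not.or
        (PolyTime.id.hd.hd.tl.nth _).polyDec_eq_nil.not))

/-- The check that every variable of a unary constraint has an admissible value. -/
def TreeCheck (D : Type*) [Fintype D] (x : BinTree) : Prop :=
  ∀ c ∈ x.tl.toList, c.hd = .nil ∨ ∃ d : D, TreeAdmissible d c.tl.hd x.tl

theorem polyDec_treeCheck : PolyDec (TreeCheck D) :=
  PolyDec.forall_mem (p := fun c x => c.hd = .nil ∨ ∃ d : D, TreeAdmissible d c.tl.hd x.tl)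
    PolyTime.id.tl (PolyTime.id.hd.hd.polyDec_eq_nil.or
      (PolyDec.exists_finite fun d => polyDec_treeAdmissible PolyTime.id.hd.tl.hd PolyTime.id.tl.tl d))

/-- `Instance.Applies` on encodings: `c` is a constraint, `x` the instance. -/
def TreeApplies (t : ι → Fin k → D) (o : Option ι) (c x : BinTree) : Prop :=
  c.hd = .nil ∧ ∀ i ∈ o, ¬ ∀ j : Fin k, TreeAdmissible (t i j) (nth j c.tl) x.tl

theorem polyDec_treeApplies (t : ι → Fin k → D) (o : Option ι) :
    PolyDec fun e => TreeApplies t o e.hd e.tl := by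
  refine PolyTime.id.hd.hd.polyDec_eq_nil.and ?_
  cases o with
  | none => exact PolyDec.true.congr fun x => by simp
  | some i =>
    refine PolyDec.congr (PolyDec.forall_finite fun j : Fin k => polyDec_treeAdmissible
      (PolyTime.id.hd.tl.nth j) PolyTime.id.tl.tl (t i j)).not fun x => ?_
    simp

/-- The constraint by the relation named `R` whose scope is that of `c` composed with `σ`. -/
def treeScope (R : BinTree) (σ : Fin k → Fin k) (c : BinTree) : BinTree :=
  .cons R (ofList (List.ofFn fun j => nth (σ j) c.tl))

theorem polyTime_treeScope (R : BinTree) (σ : Fin k → Fin k) {f : BinTree → BinTree}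
    (hf : PolyTime f) : PolyTime fun e => treeScope R σ (f e) :=
  (PolyTime.const R).cons (PolyTime.ofList_ofFn fun j => hf.tl.nth (σ j))

/-- The constraints `y` and `z` have the same scope. -/
def TreeSameScope (k : ℕ) (y z : BinTree) : Prop :=
  ∀ j : Fin k, (nth j y.tl).len = (nth j z.tl).len

theorem polyDec_treeSameScope : PolyDec fun e => TreeSameScope k e.hd e.tl :=
  PolyDec.forall_finite fun j : Fin k =>
    (PolyTime.id.hd.tl.nth j).polyDec_len_eq (PolyTime.id.tl.tl.nth j)

/-- The constraints of the reduced instance that arise from the rules in the list `l`. -/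
noncomputable def treeReduce (t : ι → Fin k → D) (τ : Option ι → Fin k → Fin k) (R x : BinTree) :
    List (Option ι) → BinTree
  | [] => .nil
  | o :: l => collect (TreeSameScope k) (TreeApplies t o) (fun c _ => treeScope R (τ o) c) x
      (treeReduce t τ R x l) x.tl.toList

theorem polyTime_treeReduce (t : ι → Fin k → D) (τ : Option ι → Fin k → Fin k) (R : BinTree)
    (l : List (Option ι)) : PolyTime fun x => treeReduce t τ R x l := by
  induction l with
  | nil => exact .const .nil
  | cons o l ih =>
    exact PolyTime.collect polyDec_treeSameScope (polyDec_treeApplies t o)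
      (polyTime_treeScope R (τ o) PolyTime.id.hd) PolyTime.id.tl ih

/-! ### Agreement of the tree procedures with their semantic counterparts -/

section Encoding

variable {t : ι → Fin k → D}

variable (I : Instance ({relOf t} ∪ allUnary D))

/-- Looking at the first argument alone suffices, since every constraint not named `nil` is unary.
-/
theorem treeAdmissible_iff (d : D) (v : Fin I.numVars) :
    TreeAdmissible d (ofNat v) (I.encode (tableName (relOf t))).tl ↔
      I.Admissible (relOf t) d v := by
  simp only [TreeAdmissible, toList_encode, List.forall_mem_map, Instance.Admissible]
  refine forall₂_congr fun c _ => ?_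
  by_cases hR : c.rel = relOf t
  · simp [hR, Constraint.encode, BinTree.hd, tableName_eq_nil]
  · have h := nth_tableName hR d
    have hd : (c.encode (tableName (relOf t))).hd = tableName (relOf t) c.rel := rfl
    rw [hd, tableName_eq_nil, h]
    obtain ⟨r, hr, w⟩ := c
    obtain ⟨E, rfl⟩ := hr.resolve_left hR
    have h₀ : (Constraint.encode (tableName (relOf t)) ⟨unaryRel E, hr, w⟩).tl.hd =
      ofNat (w (0 : Fin 1)) := rfl
    rw [h₀, len_ofNat, len_ofNat]
    simp only [hR, false_or, ne_eq, not_false_eq_true, true_imp_iff, ← Fin.ext_iff]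
    constructor
    · intro h j hj
      rw [Subsingleton.elim (α := Fin 1) j 0] at hj
      exact h.resolve_left (not_not.mpr hj)
    · intro h
      by_cases h₁ : w (0 : Fin 1) = v
      · exact Or.inr (h _ h₁)
      · exact Or.inl h₁

theorem treeCheck_iff : TreeCheck D (I.encode (tableName (relOf t))) ↔
    ∀ c ∈ I.constraints, c.rel ≠ relOf t → ∀ j, ∃ d, I.Admissible (relOf t) d (c.scope j) := by
  simp only [TreeCheck, toList_encode, List.forall_mem_map]
  refine forall₂_congr fun c _ => ?_
  have hd : (c.encode (tableName (relOf t))).hd = tableName (relOf t) c.rel := rfl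
  rw [hd, tableName_eq_nil, ← imp_iff_not_or.trans (or_congr_left not_not)]
  refine imp_congr_right fun hR => ?_
  obtain ⟨r, hr, w⟩ := c
  obtain ⟨E, rfl⟩ := hr.resolve_left hR
  have h₀ : (Constraint.encode (tableName (relOf t)) ⟨unaryRel E, hr, w⟩).tl.hd =
    ofNat (w (0 : Fin 1)) := rfl
  simp only [h₀, treeAdmissible_iff]
  exact ⟨fun h j => by rwa [Subsingleton.elim (α := Fin 1) j 0], fun h => h _⟩

theorem treeApplies_iff (o : Option ι) (w : Fin k → Fin I.numVars) :
    TreeApplies t o ((applyTo (relOf_mem t) w).encode (tableName (relOf t)))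
      (I.encode (tableName (relOf t))) ↔ I.Applies w o := by
  have hd : ((applyTo (relOf_mem t) w).encode (tableName (relOf t))).hd = .nil :=
    tableName_eq_nil.mpr rfl
  simp only [TreeApplies, hd, true_and, nth_encode_applyTo, treeAdmissible_iff]
  cases o <;> simp [Instance.Applies]

/-- The output must be the encoding of an actual instance, under the solver's own `name`; `W` lists
its scopes. Different rules may produce the same scope, hence the common accumulator. -/
theorem exists_treeReduce_eq (τ : Option ι → Fin k → Fin k) (name : Rel D → BinTree)
    (l : List (Option ι)) :
    ∃ W : List (Fin k → Fin I.numVars), W.Nodup ∧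
      treeReduce t τ (name (relOf t)) (I.encode (tableName (relOf t))) l =
        ofList (W.map fun w => (applyTo (Set.mem_singleton (relOf t)) w).encode name) ∧
      ∀ w', w' ∈ W ↔ ∃ o ∈ l, ∃ w ∈ I.scopes, I.Applies w o ∧ w' = w ∘ τ o := by
  set code : (Fin k → Fin I.numVars) → BinTree := fun w =>
    (applyTo (Set.mem_singleton (relOf t)) w).encode name with hcode
  have hn : ∀ w (j : Fin k), nth j (code w).tl = ofNat (w j) := nth_encode_applyTo _ name
  have hE : ∀ w w', TreeSameScope k (code w) (code w') ↔ w = w' := by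
    intro w w'
    simp [TreeSameScope, hn, funext_iff, Fin.ext_iff]
  induction l with
  | nil => exact ⟨[], List.nodup_nil, rfl, by simp⟩
  | cons o l ih =>
    obtain ⟨W, hW, eW, mW⟩ := ih
    have hu : ∀ w : Fin k → Fin I.numVars, treeScope (name (relOf t)) (τ o)
        ((applyTo (relOf_mem t) w).encode (tableName (relOf t))) = code (w ∘ τ o) := by
      intro w
      simp only [treeScope, nth_encode_applyTo]
      rfl
    have hR : ∀ (c : Constraint ({relOf t} ∪ allUnary D) I.numVars),
        TreeApplies t o (c.encode (tableName (relOf t))) (I.encode (tableName (relOf t))) →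
        ∃ w, c = applyTo (relOf_mem t) w := by
      rintro ⟨r, hr, w⟩ h
      obtain rfl : r = relOf t := tableName_eq_nil.mp h.1
      exact ⟨w, rfl⟩
    obtain ⟨W', hW', eW', mW'⟩ := exists_collect_eq (q := TreeApplies t o)
      (u := fun c _ => treeScope (name (relOf t)) (τ o) c)
      (x := I.encode (tableName (relOf t))) hE (l := (I.encode (tableName (relOf t))).tl.toList)
      (by
        simp only [toList_encode, List.forall_mem_map]
        intro c _ hc
        obtain ⟨w, rfl⟩ := hR c hc
        exact ⟨_, hu w⟩) hW
    refine ⟨W', hW', by rw [← eW', ← eW]; rfl, fun w' => ?_⟩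
    have hinj : Function.Injective code := fun w w' h => (hE w w').mp (h ▸ (hE w w).mpr rfl)
    simp only [mW', mW, List.mem_cons, exists_eq_or_imp, toList_encode, List.mem_map,
      exists_exists_and_eq_and]
    rw [or_comm]
    refine or_congr_left ⟨?_, ?_⟩
    · rintro ⟨c, hc, hq, e⟩
      obtain ⟨w, rfl⟩ := hR c hq
      rw [hu] at e
      exact ⟨w, hc, (treeApplies_iff I o w).mp hq, (hinj e).symm⟩
    · rintro ⟨w, hw, hq, rfl⟩
      exact ⟨_, hw, (treeApplies_iff I o w).mpr hq, hu w⟩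

end Encoding

/-! ### Equality of the exponents -/

theorem finite_union_allUnary (R : Rel D) : ({R} ∪ allUnary D : Set (Rel D)).Finite :=
  (Set.finite_singleton R).union (Set.finite_range _)

/-- Only the richness of the columns matters, so the argument works for any finite number of tuples.
-/
theorem T_relOf_eq [Fintype ι] {t : ι → Fin k → D} (ht : ∀ d : ι → D, ∃ j, ∀ i, t i j = d i) :
    T {relOf t} = T ({relOf t} ∪ allUnary D) := by
  refine le_antisymm (T_mono Set.subset_union_left) (T_le_of_forall_pos fun c ε hc hε => ?_)
  choose σ hσ₁ hσ₂ using exists_excluding ht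
  -- The rule `none` keeps the original constraint; `some i` adds the one that excludes `t i`.
  let τ : Option ι → Fin k → Fin k := fun o => o.elim id σ
  refine hc.of_reduction (finite_union_allUnary _) (fun name => ⟨tableName (relOf t), TreeCheck D,
    fun x => .cons x.hd (treeReduce t τ (name (relOf t)) x Finset.univ.toList),
    tableName_injOn _, polyDec_treeCheck, PolyTime.id.hd.cons (polyTime_treeReduce _ _ _ _),
    fun I => ?_⟩) hε
  have hI := I.satisfiable_iff (τ := τ) rfl hσ₁ fun h i => hσ₂ i h
  rw [← treeCheck_iff] at hI
  refine ⟨fun h hs => h (hI.mp hs).1, fun h => ?_⟩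
  obtain ⟨W, hW, eW, mW⟩ := exists_treeReduce_eq I τ name Finset.univ.toList
  have hinj := applyTo_injective (Set.mem_singleton (relOf t)) I.numVars
  refine ⟨⟨I.numVars, _, (List.nodup_map_iff hinj).mpr hW⟩, ?_, rfl, ?_⟩
  · beta_reduce
    rw [eW]
    simp only [Instance.encode, BinTree.hd, List.map_map]
    rfl
  · rw [hI, and_iff_right h]
    refine exists_congr fun g => ?_
    simp only [List.forall_mem_map]
    constructor
    · intro hg o w hw ho
      exact hg _ ((mW _).mpr ⟨o, by simp, w, hw, ho, rfl⟩)
    · intro hg w' hw'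
      obtain ⟨o, -, w, hw, ho, rfl⟩ := (mW w').mp hw'
      exact hg o w hw ho

theorem saturatedRel_eq_relOf (col : Fin (Fintype.card D ^ 3) ≃ D × D × D) :
    saturatedRel col = relOf fun (i : Fin 3) j => ![(col j).1, (col j).2.1, (col j).2.2] i := by
  refine congrArg (Rel.mk _) (Set.ext fun f => ?_)
  simp [Fin.exists_fin_succ, eq_comm (b := f)]

end Trees

end CSP

theorem mainTheorem4 {D : Type*} [Fintype D]
    (col : Fin (Fintype.card D ^ 3) ≃ D × D × D) :
    CSP.T ({CSP.saturatedRel col} : Set (CSP.Rel D)) =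
      CSP.T ({CSP.saturatedRel col} ∪ CSP.allUnary D) := by
  rw [CSP.saturatedRel_eq_relOf]
  refine CSP.T_relOf_eq fun d => ⟨col.symm (d 0, d 1, d 2), fun i => ?_⟩
  fin_cases i <;> simp
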